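/- For a well-ordered set $X$ and an ordinal $\alpha$, let $[X]^\alpha$ be the set of all subsets of $X$ of order type $\alpha$. For ordinals $\alpha,\beta_0,\beta_1$, the relation $\alpha\longrightarrow(\beta_0,\beta_1)^2$ means: for every $f:[\alpha]^2\to\{0,1\}$ there are $i<2$ and $X\in[\alpha]^{\beta_i}$ such that $f$ takes the constant value $i$ on $[X]^2$; and $\alpha\not\longrightarrow(\beta_0,\beta_1)^2$ is its negation. For an infinite cardinal $\kappa$, let \begin{itemize} \item $\mathfrak b_\kappa$ be the least cardinality of a family $A$ of functions from $\kappa$ to $\kappa$ such that for every $f:\kappa\to\kappa$ there is $g\in A$ with $|\{\alpha<\kappa : f(\alpha)<g(\alpha)\}|=\kappa$; \item $\mathrm{stick}(\kappa)$ be the least cardinality of a family $X\subseteq[\kappa^+]^{\kappa}$ such that every $y\in[\kappa^+]^{\kappa^+}$ has a subset $x\subseteq y$ with $x\in X$. \end{itemize} \textbf{Theorem.} Let $\kappa$ be an infinite regular cardinal and suppose that $\lambda=\kappa^+=\mathfrak b_\kappa=\mathrm{stick}(\kappa)$. Then $$\lambda^2\not\longrightarrow(\lambda\kappa,4)^2,$$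 where $\lambda^2$ and $\lambda\kappa$ denote ordinal products ($\lambda\kappa$ is the order type of $\kappa$ consecutive copies of $\lambda$). In other words, there is a graph with vertex set $\lambda^2$ that has neither a complete subgraph on four vertices nor an independent set of order type $\lambda\kappa$. -/

import Mathlib

open Cardinal Ordinal

universe u

/-- `[X]^α`: the set of all subsets of the well-ordered set `X` that have order type `α`. -/
def subsetsOfType (X : Type u) [LinearOrder X] [WellFoundedLT X] (α : Ordinal.{u}) :
    Set (Set X) :=
  {s | Ordinal.type (fun a b : s => a < b) = α}

/-- The ordinary partition relation `α ⟶ (β_i : i < m)^k_m`: for every colouring `f` of the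
`k`-element subsets of `α` with `m` colours there are a colour `i` and a subset `X` of `α` of order
type `β_i` all of whose `k`-element subsets have colour `i`. -/
def PartitionRelation (α : Ordinal.{u}) (k : ℕ) {m : ℕ} (β : Fin m → Ordinal.{u}) : Prop :=
  ∀ f : Set.powersetCard α.ToType k → Fin m,
    ∃ i : Fin m, ∃ X ∈ subsetsOfType α.ToType (β i),
      ∀ s : Set.powersetCard α.ToType k, ((s : Finset α.ToType) : Set α.ToType) ⊆ X → f s = i

/-- The unbounding number `𝔟_κ`: the least cardinality of a family `A` of functions from `κ` to `κ`
such that for every `f : κ → κ` there is `g ∈ A` with `|{α < κ | f α < g α}| = κ`. (Such families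
exist whenever `κ` is infinite, so the infimum is then a minimum.) -/
noncomputable def unboundingNumber (κ : Cardinal.{u}) : Cardinal.{u} :=
  sInf {c | ∃ A : Set (κ.ord.ToType → κ.ord.ToType), #A = c ∧
    ∀ f : κ.ord.ToType → κ.ord.ToType, ∃ g ∈ A, #{α : κ.ord.ToType | f α < g α} = κ}

/-- The two-parameter stick number for cardinals `κ ≤ μ`: the least cardinality of a family
`X ⊆ [μ]^κ` such that every `y ∈ [μ]^μ` has a subset that belongs to `X`. -/
noncomputable def stickNumber₂ (κ μ : Cardinal.{u}) : Cardinal.{u} :=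
  sInf {c | ∃ X : Set (Set μ.ord.ToType), #X = c ∧ X ⊆ subsetsOfType μ.ord.ToType κ.ord ∧
    ∀ y ∈ subsetsOfType μ.ord.ToType μ.ord, ∃ x ∈ X, x ⊆ y}

/-- The stick number of `κ`, which is the two-parameter stick number of `κ` and `κ⁺`. -/
noncomputable def stickNumber (κ : Cardinal.{u}) : Cardinal.{u} :=
  stickNumber₂ κ (Order.succ κ)

/-! ### Boundedness in well-orders of regular type -/

section RegularOrder

/-! View `λ²` as `λ × λ`, a point being (column, row). Fix a subadditive `ρ : [λ]² → κ` whose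
sublevel sets are smaller than `κ`. Join `(b, ξ)` to `(c, η)` when `b < c < ξ`, `ρ b ξ < ρ c ξ` and
`η ∈ E ξ c`, for suitable sets `E ξ c` with fewer than `κ` elements.

No complete subgraph on four vertices: the sets `E` avoid each other so that a triangle with columns
`b < c < d`, whose first vertex has row `ξ`, satisfies `ρ d ξ < ρ c ξ`. For four vertices these
inequalities contradict subadditivity (`not_ladderAdj_four`).

No independent set of type `λκ`: such a set has `λ` points in each of `κ` increasing columns
(`exists_strictMono_columns`), so each of these columns contains a stick set `x i`. Each `E ξ c` can
meet only fewer than `κ` stick sets; an unbounded family of `λ` functions selects which, and one of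
its members catches a column whose stick set must be met (`exists_ladder_graph`). -/

/-- A well-order of regular cardinality all of whose proper initial segments are smaller. -/
structure IsRegularOrder (X : Type u) [LinearOrder X] : Prop where
  isRegular : (#X).IsRegular
  mk_Iio_lt : ∀ x : X, #(Set.Iio x) < #X

theorem isRegularOrder_ord_toType {c : Cardinal.{u}} (hc : c.IsRegular) :
    IsRegularOrder c.ord.ToType where
  isRegular := by rwa [mk_ord_toType]
  mk_Iio_lt x := by
    exact Cardinal.mk_Iio_lt x (by simp)

namespace IsRegularOrder

variable {X : Type u} [LinearOrder X]

theorem mk_Iic_lt (hX : IsRegularOrder X) (x : X) : #(Set.Iic x) < #X := by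
  rw [← Set.Iio_insert]
  refine (mk_insert_le).trans_lt ?_
  exact add_lt_of_lt hX.isRegular.aleph0_le (hX.mk_Iio_lt x)
    (one_lt_aleph0.trans_le hX.isRegular.aleph0_le)

theorem exists_forall_lt (hX : IsRegularOrder X) {s : Set X} (hs : #s < #X) :
    ∃ b, ∀ a ∈ s, a < b := by
  by_contra! h
  have hu : (⋃ a ∈ s, Set.Iic a) = Set.univ := by
    ext b
    simpa using h b
  have := (card_biUnion_lt_iff_forall_of_isRegular (t := fun a _ => Set.Iic a)
    hX.isRegular hs).2 fun a _ => hX.mk_Iic_lt a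
  rw [hu, mk_univ] at this
  exact this.false

theorem exists_forall_apply_lt (hX : IsRegularOrder X) {ι : Type u} (hι : #ι < #X)
    (f : ι → X) : ∃ b, ∀ i, f i < b := by
  obtain ⟨b, hb⟩ := hX.exists_forall_lt (s := Set.range f) (mk_range_le.trans_lt hι)
  exact ⟨b, fun i => hb _ ⟨i, rfl⟩⟩

theorem exists_mem_ge (hX : IsRegularOrder X) {s : Set X} (hs : #s = #X) (b : X) :
    ∃ a ∈ s, b ≤ a := by
  by_contra! h
  exact ((mk_le_mk_of_subset (show s ⊆ Set.Iio b from h)).trans_lt (hX.mk_Iio_lt b)).ne hs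

theorem exists_gt (hX : IsRegularOrder X) (b : X) : ∃ a, b < a := by
  obtain ⟨a, ha⟩ := hX.exists_forall_lt (s := {b})
    (by simpa using one_lt_aleph0.trans_le hX.isRegular.aleph0_le)
  exact ⟨a, ha b rfl⟩

end IsRegularOrder

end RegularOrder

/-! ### Recursion on restrictions -/

section Recursion

/-- Well-founded recursion for functions whose value at `x` is computed from the restriction
to the elements below `x`. -/
theorem exists_recursive_fun {W V : Type*} {r : W → W → Prop} (hr : WellFounded r)
    (Φ : (W → Set V) → W → Set V) :
    ∃ E : W → Set V, ∀ x, E x = Φ (fun y => {v | r y x ∧ v ∈ E y}) x := by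
  refine ⟨hr.fix fun x f => Φ (fun y => {v | ∃ h : r y x, v ∈ f y h}) x, fun x => ?_⟩
  rw [hr.fix_eq]
  congr 1
  ext y v
  simp

end Recursion

/-! ### Subadditive functions from coherent filtrations -/

section Subadditive

/-- A function on pairs of `L` with values in `K` that is subadditive in the two ultrametric
senses and whose sublevel sets are smaller than `K`. -/
structure IsSubadditive {K L : Type u} [LinearOrder K] [LinearOrder L] (ρ : L → L → K) :
    Prop where
  mk_lt : ∀ b t, #{a | a < b ∧ ρ a b ≤ t} < #K
  le_max₁ : ∀ {a b c}, a < b → b < c → ρ a c ≤ max (ρ a b) (ρ b c)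
  le_max₂ : ∀ {a b c}, a < b → b < c → ρ a b ≤ max (ρ a c) (ρ b c)

variable {K L : Type u} [LinearOrder K] [LinearOrder L]

/-- A coherent system of filtrations of the initial segments of `L`. -/
theorem exists_coherent_filtration [WellFoundedLT L] (hK : IsRegularOrder K)
    (hL : ∀ x : L, #(Set.Iio x) ≤ #K) :
    ∃ P : L → K → Set L,
      (∀ x t, #(P x t) < #K) ∧ (∀ x, Monotone (P x)) ∧
      (∀ x, ∀ a < x, ∃ t, a ∈ P x t) ∧
      ∀ x t, ∀ b ∈ P x t, ∀ a < b, a ∈ P b t ↔ a ∈ P x t := by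
  have hf : ∀ x : L, ∃ f : L → K, Set.InjOn f (Set.Iio x) := by
    intro x
    obtain ⟨g⟩ := hL x
    obtain ⟨k⟩ : Nonempty K := mk_ne_zero_iff.1 hK.isRegular.ne_zero
    classical
    refine ⟨fun y => if h : y < x then g ⟨y, h⟩ else k, fun a ha b hb hab => ?_⟩
    simp only [Set.mem_Iio] at ha hb
    simp only [ha, hb, dif_pos] at hab
    exact congrArg Subtype.val (g.injective hab)
  choose f hf using hf
  obtain ⟨E, hE⟩ := exists_recursive_fun (W := L) (V := L × K) (r := (· < ·)) wellFounded_lt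
    -- A generator `c` is admitted at stage `t` only if all points of `f x`-index at most that of
    -- `c` already cohere pairwise at stage `t`; it brings its own stage `t` along.
    (fun E x => {p | ∃ c < x, f x c ≤ p.2 ∧
      (∀ a b, a < b → b < x → f x a ≤ f x c → f x b ≤ f x c → (a, p.2) ∈ E b) ∧
      (p.1 = c ∨ p ∈ E c)})
  have hmem : ∀ x a t, (a, t) ∈ E x ↔ ∃ c < x, f x c ≤ t ∧
      (∀ a b, a < b → b < x → f x a ≤ f x c → f x b ≤ f x c → (a, t) ∈ E b) ∧
      (a = c ∨ (a, t) ∈ E c) := by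
    intro x a t
    conv_lhs => rw [hE x]
    simp only [Set.mem_ofPred_eq]
    constructor
    · rintro ⟨c, h1, h2, h3, h4⟩
      exact ⟨c, h1, h2, fun a b h h' h'' h''' => (h3 a b h h' h'' h''').2, h4.imp_right And.right⟩
    · rintro ⟨c, h1, h2, h3, h4⟩
      exact ⟨c, h1, h2, fun a b h h' h'' h''' => ⟨h', h3 a b h h' h'' h'''⟩,
        h4.imp_right fun h => ⟨h1, h⟩⟩
  have hlt : ∀ x a t, (a, t) ∈ E x → a < x := by
    intro x
    induction x using WellFoundedLT.induction with
    | ind x ih =>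
      intro a t h
      obtain ⟨c, hc, -, -, rfl | h⟩ := (hmem x a t).1 h
      · exact hc
      · exact (ih c hc a t h).trans hc
  have hmono : ∀ x a t s, t ≤ s → (a, t) ∈ E x → (a, s) ∈ E x := by
    intro x
    induction x using WellFoundedLT.induction with
    | ind x ih =>
      intro a t s hts h
      obtain ⟨c, hc, hct, hch, hac⟩ := (hmem x a t).1 h
      exact (hmem x a s).2 ⟨c, hc, hct.trans hts,
        fun a b h h' h'' h''' => ih b h' a t s hts (hch a b h h' h'' h'''),
        hac.imp_right (ih c hc a t s hts)⟩
  have hcoh : ∀ x t b, (b, t) ∈ E x → ∀ a < b, (a, t) ∈ E b ↔ (a, t) ∈ E x := by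
    intro x
    induction x using WellFoundedLT.induction with
    | ind x ih =>
      intro t b hb a hab
      obtain ⟨c, hc, hct, hch, hbc⟩ := (hmem x b t).1 hb
      constructor
      · intro ha
        refine (hmem x a t).2 ⟨c, hc, hct, hch, Or.inr ?_⟩
        rcases hbc with rfl | hbc
        · exact ha
        · exact (ih c hc t b hbc a hab).1 ha
      · intro ha
        obtain ⟨d, hd, hdt, hdh, had⟩ := (hmem x a t).1 ha
        have key : ∀ e, e < x → (b = e ∨ (b, t) ∈ E e) → (a, t) ∈ E e → (a, t) ∈ E b := by
          intro e he hbe hae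
          rcases hbe with rfl | hbe
          · exact hae
          · exact (ih e he t b hbe a hab).2 hae
        -- Two generators always cohere: the one of larger index certifies the pair.
        have hcd : c < d → (c, t) ∈ E d := by
          intro h
          rcases le_total (f x c) (f x d) with h' | h'
          · exact hdh c d h hd h' le_rfl
          · exact hch c d h hd le_rfl h'
        have hdc : d < c → (d, t) ∈ E c := by
          intro h
          rcases le_total (f x c) (f x d) with h' | h'
          · exact hdh d c h hc le_rfl h'
          · exact hch d c h hc h' le_rfl
        rcases lt_trichotomy c d with h | rfl | h
        · have hbd : (b, t) ∈ E d := by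
            rcases hbc with rfl | hbc
            · exact hcd h
            · exact (ih d hd t c (hcd h) b (hlt _ _ _ hbc)).1 hbc
          have had' : (a, t) ∈ E d := by
            rcases had with rfl | had
            · exact absurd (hab.trans (hlt _ _ _ hbd)) (lt_irrefl _)
            · exact had
          exact key d hd (Or.inr hbd) had'
        · have hac : (a, t) ∈ E c := by
            rcases had with rfl | had
            · rcases hbc with rfl | hbc
              · exact absurd hab (lt_irrefl _)
              · exact absurd (hab.trans (hlt _ _ _ hbc)) (lt_irrefl _)
            · exact had
          exact key c hc hbc hac
        · have hac : (a, t) ∈ E c := by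
            rcases had with rfl | had
            · exact hdc h
            · exact (ih c hc t d (hdc h) a (hlt _ _ _ had)).1 had
          exact key c hc hbc hac
  have hsmall : ∀ x s, #{c | c < x ∧ f x c ≤ s} < #K := by
    intro x s
    refine lt_of_le_of_lt ?_ (hK.mk_Iic_lt s)
    refine mk_le_of_injective (f := fun c : {c | c < x ∧ f x c ≤ s} =>
      (⟨f x c, c.2.2⟩ : Set.Iic s)) ?_
    rintro ⟨c, hc⟩ ⟨d, hd⟩ h
    exact Subtype.ext (hf x hc.1 hd.1 (congrArg Subtype.val h))
  have hcard : ∀ x t, #{a | (a, t) ∈ E x} < #K := by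
    intro x
    induction x using WellFoundedLT.induction with
    | ind x ih =>
      intro t
      have hsub : {a | (a, t) ∈ E x} ⊆ {c | c < x ∧ f x c ≤ t} ∪
          ⋃ c ∈ {c | c < x ∧ f x c ≤ t}, {a | (a, t) ∈ E c} := by
        intro a ha
        obtain ⟨c, hc, hct, -, rfl | h⟩ := (hmem x a t).1 ha
        · exact Or.inl ⟨hc, hct⟩
        · exact Or.inr (Set.mem_biUnion (show c ∈ {c | c < x ∧ f x c ≤ t} from ⟨hc, hct⟩) h)
      refine ((mk_le_mk_of_subset hsub).trans (mk_union_le _ _)).trans_lt ?_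
      refine add_lt_of_lt hK.isRegular.aleph0_le (hsmall x t) ?_
      exact (card_biUnion_lt_iff_forall_of_isRegular
        (t := fun c _ => {a | (a, t) ∈ E c}) hK.isRegular (hsmall x t)).2
        fun c hc => ih c hc.1 t
  have hcover : ∀ x, ∀ a < x, ∃ t, (a, t) ∈ E x := by
    intro x
    induction x using WellFoundedLT.induction with
    | ind x ih =>
      intro a ha
      -- Fewer than `κ` pairs must cohere for `a` to be a generator, so one stage serves them all.
      let S : Set L := {c | c < x ∧ f x c ≤ f x a}
      have hT : ∀ p : S × S, ∃ t, p.1.1 < p.2.1 → (p.1.1, t) ∈ E p.2.1 := by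
        rintro ⟨⟨c, hc⟩, ⟨d, hd⟩⟩
        by_cases h : c < d
        · obtain ⟨t, ht⟩ := ih d hd.1 c h
          exact ⟨t, fun _ => ht⟩
        · exact ⟨f x a, fun h' => absurd h' h⟩
      choose T hT using hT
      obtain ⟨t, ht⟩ := hK.exists_forall_apply_lt (ι := S × S) (by
        rw [mk_prod, Cardinal.lift_id]
        exact mul_lt_of_lt hK.isRegular.aleph0_le (hsmall x _) (hsmall x _)) T
      refine ⟨max t (f x a), (hmem x a _).2 ⟨a, ha, le_max_right _ _, ?_, Or.inl rfl⟩⟩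
      intro c d hcd hd hc' hd'
      let p : S × S := (⟨c, hcd.trans hd, hc'⟩, ⟨d, hd, hd'⟩)
      exact hmono _ _ _ _ ((ht p).le.trans (le_max_left _ _)) (hT p hcd)
  exact ⟨fun x t => {a | (a, t) ∈ E x}, hcard,
    fun x t s hts a ha => hmono x a t s hts ha, hcover, fun x t b hb a ha => hcoh x t b hb a ha⟩

/-- For `a < b`, `ρ a b` is the least stage at which `a` enters the filtration of `b`; the two
directions of coherence give the two inequalities. -/
theorem exists_isSubadditive [WellFoundedLT K] [WellFoundedLT L]
    (hK : IsRegularOrder K) (hL : ∀ x : L, #(Set.Iio x) ≤ #K) :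
    ∃ ρ : L → L → K, IsSubadditive ρ := by
  obtain ⟨P, hcard, hmono, hcover, hcoh⟩ := exists_coherent_filtration hK hL
  obtain ⟨k⟩ : Nonempty K := mk_ne_zero_iff.1 hK.isRegular.ne_zero
  have hρ : ∀ a b : L, ∃ t : K, a < b → ∀ s, a ∈ P b s ↔ t ≤ s := by
    intro a b
    by_cases h : a < b
    · obtain ⟨t, ht, hmin⟩ := wellFounded_lt.has_min {t | a ∈ P b t} (hcover b a h)
      exact ⟨t, fun _ s => ⟨fun hs => not_lt.1 (hmin s hs), fun hs => hmono b hs ht⟩⟩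
    · exact ⟨k, fun h' => absurd h' h⟩
  choose ρ hρ using hρ
  refine ⟨ρ, fun b t => ?_, fun {a b c} hab hbc => ?_, fun {a b c} hab hbc => ?_⟩
  · refine (mk_le_mk_of_subset ?_).trans_lt (hcard b t)
    rintro a ⟨ha, hat⟩
    exact (hρ a b ha t).2 hat
  · have h1 := (hρ b c hbc _).2 (le_max_right (ρ a b) (ρ b c))
    have h2 := (hρ a b hab _).2 (le_max_left (ρ a b) (ρ b c))
    exact (hρ a c (hab.trans hbc) _).1 ((hcoh c _ b h1 a hab).1 h2)
  · have h1 := (hρ b c hbc _).2 (le_max_right (ρ a c) (ρ b c))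
    have h2 := (hρ a c (hab.trans hbc) _).2 (le_max_left (ρ a c) (ρ b c))
    exact (hρ a b hab _).1 ((hcoh c _ b h1 a hab).2 h2)

end Subadditive

/-! ### The graph: no four-clique, no large independent set -/

section Graph

variable {K L : Type u} [LinearOrder K] [LinearOrder L]

/-- Small sets `E ξ b` of rows that avoid each other along `ρ` and meet prescribed large sets. -/
theorem exists_avoiding_family [WellFoundedLT L] [Nonempty L] (hK : IsRegularOrder K)
    {ρ : L → L → K} (hρ : IsSubadditive ρ) (G : L → L → Set L) (hG : ∀ ξ b, #(G ξ b) < #K)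
    (x : L → Set L) (hx : ∀ i, #(x i) = #K) :
    ∃ E : L → L → Set L,
      (∀ ξ b c, b < c → c < ξ → ρ b ξ ≤ ρ c ξ → ∀ η ∈ E ξ b, Disjoint (E η c) (E ξ c)) ∧
      ∀ ξ b, b < ξ → ∀ i ∈ G ξ b, x i ⊆ Set.Iio ξ → (E ξ b ∩ x i).Nonempty := by
  -- The points that disjointness forbids. By regularity there are fewer than `κ` of them, so they
  -- never exhaust an `x i`.
  let bad : (L × L → Set L) → L × L → Set L := fun E p =>
    ⋃ b ∈ {b | (b < p.2 ∧ b < p.1) ∧ ρ b p.1 ≤ ρ p.2 p.1},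
      ⋃ η ∈ {η | η < p.1 ∧ η ∈ E (p.1, b)}, E (η, p.2)
  let pick : Set L → L := fun s => Classical.epsilon (· ∈ s)
  have hpick : ∀ s : Set L, s.Nonempty → pick s ∈ s := fun s h => Classical.epsilon_spec h
  obtain ⟨E, hE⟩ := exists_recursive_fun (W := L × L) (V := L)
    (r := Prod.Lex (· < ·) (· < ·)) (WellFounded.prod_lex wellFounded_lt wellFounded_lt)
    (fun E p => {a | ∃ i ∈ G p.1 p.2, ((x i ∩ Set.Iio p.1) \ bad E p).Nonempty ∧
      a = pick ((x i ∩ Set.Iio p.1) \ bad E p)})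
  have hbad : ∀ p, bad (fun q => {v | Prod.Lex (· < ·) (· < ·) q p ∧ v ∈ E q}) p = bad E p := by
    rintro ⟨ξ, c⟩
    ext a
    simp only [bad, Set.mem_iUnion, Set.mem_ofPred_eq, exists_prop]
    constructor
    · rintro ⟨b, h1, η, h2, -, h3⟩
      exact ⟨b, h1, η, ⟨h2.1, h2.2.2⟩, h3⟩
    · rintro ⟨b, h1, η, h2, h3⟩
      exact ⟨b, h1, η, ⟨h2.1, Prod.Lex.right _ h1.1.1, h2.2⟩, Prod.Lex.left _ _ h2.1, h3⟩
  have hmem : ∀ ξ b a, a ∈ E (ξ, b) ↔ ∃ i ∈ G ξ b,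
      ((x i ∩ Set.Iio ξ) \ bad E (ξ, b)).Nonempty ∧
        a = pick ((x i ∩ Set.Iio ξ) \ bad E (ξ, b)) := by
    intro ξ b a
    conv_lhs => rw [hE (ξ, b)]
    simp only [Set.mem_ofPred_eq, hbad]
  have hspec : ∀ ξ b a, a ∈ E (ξ, b) → a < ξ ∧ a ∉ bad E (ξ, b) := by
    intro ξ b a ha
    obtain ⟨i, -, hne, rfl⟩ := (hmem ξ b a).1 ha
    exact ⟨(hpick _ hne).1.2, (hpick _ hne).2⟩
  have hcard : ∀ p, #(E p) < #K := by
    rintro ⟨ξ, b⟩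
    refine lt_of_le_of_lt ?_ (hG ξ b)
    refine (mk_le_mk_of_subset (t := (fun i => pick ((x i ∩ Set.Iio ξ) \ bad E (ξ, b))) '' G ξ b)
      ?_).trans mk_image_le
    intro a ha
    obtain ⟨i, hi, -, rfl⟩ := (hmem ξ b a).1 ha
    exact ⟨i, hi, rfl⟩
  have hbadcard : ∀ p, #(bad E p) < #K := by
    rintro ⟨ξ, c⟩
    have h1 : #{b | (b < c ∧ b < ξ) ∧ ρ b ξ ≤ ρ c ξ} < #K :=
      (mk_le_mk_of_subset (show _ ⊆ {b | b < ξ ∧ ρ b ξ ≤ ρ c ξ} from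
        fun b hb => ⟨hb.1.2, hb.2⟩)).trans_lt (hρ.mk_lt ξ (ρ c ξ))
    refine (card_biUnion_lt_iff_forall_of_isRegular (t := fun b _ =>
      ⋃ η ∈ {η | η < ξ ∧ η ∈ E (ξ, b)}, E (η, c)) hK.isRegular h1).2 fun b _ => ?_
    have h2 : #{η | η < ξ ∧ η ∈ E (ξ, b)} < #K :=
      (mk_le_mk_of_subset fun η hη => hη.2).trans_lt (hcard (ξ, b))
    exact (card_biUnion_lt_iff_forall_of_isRegular (t := fun η _ => E (η, c))
      hK.isRegular h2).2 fun η _ => hcard _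
  refine ⟨fun ξ b => E (ξ, b), ?_, ?_⟩
  · intro ξ b c hbc hcξ hle η hη
    refine Set.disjoint_left.2 fun a ha ha' => (hspec ξ c a ha').2 ?_
    exact Set.mem_biUnion (show b ∈ {b | (b < c ∧ b < ξ) ∧ ρ b ξ ≤ ρ c ξ} from
      ⟨⟨hbc, hbc.trans hcξ⟩, hle⟩) (Set.mem_biUnion
        (show η ∈ {η | η < ξ ∧ η ∈ E (ξ, b)} from ⟨(hspec _ _ _ hη).1, hη⟩) ha)
  · intro ξ b _ i hi hxi
    have hne : ((x i ∩ Set.Iio ξ) \ bad E (ξ, b)).Nonempty := by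
      rw [Set.inter_eq_left.2 hxi]
      by_contra h
      rw [Set.not_nonempty_iff_eq_empty, Set.sdiff_eq_empty] at h
      exact ((mk_le_mk_of_subset h).trans_lt (hbadcard _)).ne (hx i)
    exact ⟨_, (hmem ξ b _).2 ⟨i, hi, hne, rfl⟩, (hpick _ hne).1.1⟩

/-- The point `p` of `L × L` is joined to the point `q` in a later column and an earlier row. -/
def ladderAdj (ρ : L → L → K) (E : L → L → Set L) (p q : L × L) : Prop :=
  p.1 < q.1 ∧ q.1 < p.2 ∧ ρ p.1 p.2 < ρ q.1 p.2 ∧ q.2 ∈ E p.2 q.1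

theorem not_ladderAdj_four {ρ : L → L → K} (hρ : IsSubadditive ρ) {E : L → L → Set L}
    (hdisj : ∀ ξ b c, b < c → c < ξ → ρ b ξ ≤ ρ c ξ → ∀ η ∈ E ξ b, Disjoint (E η c) (E ξ c))
    {p q r s : L × L} (hpq : ladderAdj ρ E p q) (hpr : ladderAdj ρ E p r)
    (hps : ladderAdj ρ E p s) (hqr : ladderAdj ρ E q r) (hqs : ladderAdj ρ E q s)
    (hrs : ladderAdj ρ E r s) : False := by
  -- Otherwise `r.2` lies in both `E q.2 r.1` and `E p.2 r.1`, which are disjoint.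
  have key : ∀ {p q r : L × L}, ladderAdj ρ E p q → ladderAdj ρ E p r → ladderAdj ρ E q r →
      ρ r.1 p.2 < ρ q.1 p.2 := by
    intro p q r hpq hpr hqr
    by_contra! h
    exact Set.disjoint_left.1 (hdisj p.2 q.1 r.1 hqr.1 hpr.2.1 h q.2 hpq.2.2.2)
      hqr.2.2.2 hpr.2.2.2
  have h1 := key hpq hpr hqr
  have h2 := key hpr hps hrs
  have h3 := key hqr hqs hrs
  have h4 := hqs.2.2.1
  have e1 := hρ.le_max₁ hqs.1 hps.2.1
  have e2 := hρ.le_max₂ hqs.1 hqs.2.1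
  have e3 := hρ.le_max₁ hrs.1 hqs.2.1
  have e4 := hρ.le_max₂ hrs.1 hps.2.1
  simp only [le_max_iff] at e1 e2 e3 e4
  have e1' : ρ q.1 p.2 ≤ ρ q.1 s.1 := e1.resolve_right (h2.trans h1).not_ge
  have e2' : ρ q.1 s.1 ≤ ρ s.1 q.2 := e2.elim (fun h => h.trans h4.le) id
  have e3' : ρ r.1 q.2 ≤ ρ r.1 s.1 := e3.resolve_right h3.not_ge
  have e4' : ρ r.1 s.1 ≤ ρ r.1 p.2 := e4.elim id (fun h => h.trans h2.le)
  exact (e1'.trans (e2'.trans (h3.le.trans (e3'.trans e4')))).not_gt h1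

theorem exists_ladder_graph [WellFoundedLT K] [WellFoundedLT L]
    (hK : IsRegularOrder K) (hL : IsRegularOrder L)
    (hKL : #L = Order.succ #K) (g : L → K → K)
    (hg : ∀ f : K → K, ∃ ν, #{t | f t < g ν t} = #K)
    (x : L → Set L) (hx : ∀ i, #(x i) = #K)
    (hstick : ∀ Y : Set L, #Y = #L → ∃ i, x i ⊆ Y) :
    ∃ R : L × L → L × L → Prop,
      (∀ p q, R p q → p.1 < q.1) ∧
      (∀ p q r s, R p q → R p r → R p s → R q r → R q s → R r s → False) ∧
      ∀ (d : K → L) (Y : K → Set L), StrictMono d → (∀ k, #(Y k) = #L) →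
        ∃ k l, ∃ ξ ∈ Y k, ∃ η ∈ Y l, R (d k, ξ) (d l, η) := by
  have hlt : #K < #L := hKL ▸ Order.lt_succ _
  obtain ⟨ρ, hρ⟩ := exists_isSubadditive (L := L) hK
    fun x => Order.lt_succ_iff.1 (hKL ▸ hL.mk_Iio_lt x)
  -- Indices of the stick sets `E ξ b` must meet: `ρ i ξ` is bounded via `g ν s`, with `s` and `ρ ν
  -- ξ` at most `ρ b ξ`.
  let G : L → L → Set L := fun ξ b =>
    ⋃ ν ∈ {ν | ν < ξ ∧ ρ ν ξ ≤ ρ b ξ}, ⋃ s ∈ Set.Iic (ρ b ξ), {i | i < ξ ∧ ρ i ξ ≤ max (g ν s) s}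
  have hG : ∀ ξ b, #(G ξ b) < #K := fun ξ b =>
    (card_biUnion_lt_iff_forall_of_isRegular hK.isRegular (hρ.mk_lt ξ (ρ b ξ))).2 fun ν _ =>
      (card_biUnion_lt_iff_forall_of_isRegular hK.isRegular (hK.mk_Iic_lt _)).2 fun s _ =>
        hρ.mk_lt ξ _
  have : Nonempty L := mk_ne_zero_iff.1 hL.isRegular.ne_zero
  obtain ⟨E, hdisj, hmeet⟩ := exists_avoiding_family hK hρ G hG x hx
  refine ⟨ladderAdj ρ E, fun p q h => h.1, fun p q r s => not_ladderAdj_four hρ hdisj, ?_⟩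
  intro d Y hd hY
  obtain ⟨k₀, hk₀⟩ : ∃ k₀ : K, ∀ k, k₀ ≤ k := by
    obtain ⟨k⟩ : Nonempty K := mk_ne_zero_iff.1 hK.isRegular.ne_zero
    obtain ⟨k₀, -, h⟩ := wellFounded_lt.has_min (Set.univ : Set K) ⟨k, trivial⟩
    exact ⟨k₀, fun k => not_lt.1 (h k trivial)⟩
  choose i hi using fun k => hstick (Y k) (hY k)
  obtain ⟨σ₁, hσ₁⟩ := hL.exists_forall_apply_lt hlt d
  obtain ⟨σ₂, hσ₂⟩ := hL.exists_forall_apply_lt hlt i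
  have hxbdd : ∀ k, ∃ b, ∀ a ∈ x (i k), a < b := fun k =>
    hL.exists_forall_lt ((hx (i k)).trans_lt hlt)
  choose τ hτ using hxbdd
  obtain ⟨τ', hτ'⟩ := hL.exists_forall_apply_lt hlt τ
  let σ := max σ₁ σ₂
  have hdσ : ∀ k, d k < σ := fun k => (hσ₁ k).trans_le (le_max_left _ _)
  have hiσ : ∀ k, i k < σ := fun k => (hσ₂ k).trans_le (le_max_right _ _)
  -- `κ` distinct columns do not fit in one sublevel set.
  have hcol : ∀ t, ∃ k, t < ρ (d k) σ := by
    intro t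
    by_contra! h
    have := mk_le_mk_of_subset (show Set.range d ⊆ {a | a < σ ∧ ρ a σ ≤ t} by
      rintro _ ⟨k, rfl⟩
      exact ⟨hdσ k, h k⟩)
    rw [mk_range_eq d hd.injective] at this
    exact (this.trans_lt (hρ.mk_lt σ t)).false
  choose c hc using hcol
  obtain ⟨ν, hν⟩ := hg fun t => ρ (i (c t)) σ
  obtain ⟨ξ₀, hξ₀⟩ := hL.exists_gt (max (max σ ν) τ')
  obtain ⟨ξ, hξY, hξ⟩ := hL.exists_mem_ge (hY k₀) ξ₀
  have hξ' := hξ₀.trans_le hξ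
  simp only [max_lt_iff] at hξ'
  obtain ⟨⟨hσξ, hνξ⟩, hτξ⟩ := hξ'
  -- Once `t` is at least `ρ σ ξ`, subadditivity transfers the estimates from `σ`, fixed before `ξ`,
  -- to `ξ`.
  obtain ⟨t, ht, htge⟩ := hK.exists_mem_ge hν (max (max (ρ σ ξ) (ρ ν ξ)) (ρ (d k₀) ξ))
  simp only [max_le_iff] at htge
  obtain ⟨⟨hσt, hνt⟩, hk₀t⟩ := htge
  have hck : t < ρ (d (c t)) ξ := by
    have := (hc t).trans_le (hρ.le_max₂ (hdσ (c t)) hσξ)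
    exact (lt_max_iff.1 this).resolve_right hσt.not_gt
  have hiG : i (c t) ∈ G ξ (d (c t)) := by
    refine Set.mem_biUnion (show ν ∈ {ν | ν < ξ ∧ ρ ν ξ ≤ ρ (d (c t)) ξ} from
      ⟨hνξ, hνt.trans hck.le⟩) (Set.mem_biUnion (show t ∈ Set.Iic _ from hck.le) ?_)
    exact ⟨(hiσ _).trans hσξ, (hρ.le_max₁ (hiσ _) hσξ).trans (max_le_max (le_of_lt ht) hσt)⟩
  have hlt₀ : k₀ < c t := by
    refine lt_of_le_of_ne (hk₀ _) fun h => ?_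
    rw [← h] at hck
    exact hck.not_ge hk₀t
  have hdξ : d (c t) < ξ := (hdσ _).trans hσξ
  obtain ⟨η, hηE, hηx⟩ := hmeet ξ _ hdξ _ hiG
    fun a ha => (hτ _ a ha).trans ((hτ' _).trans hτξ)
  exact ⟨k₀, c t, ξ, hξY, η, hi _ hηx, hd hlt₀, hdξ, hk₀t.trans_lt hck, hηE⟩

end Graph

/-! ### Columns of a copy of `λκ` -/

section Columns

variable {K L : Type u} [LinearOrder K] [LinearOrder L]

/-- A copy of the lexicographic product of `K` with `L` inside that of `L` with itself has
large intersection with each of an increasing sequence of columns. -/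
theorem exists_strictMono_columns (hK : IsRegularOrder K) (hL : IsRegularOrder L)
    (φ : K × L → L × L)
    (hφ : ∀ p q, Prod.Lex (· < ·) (· < ·) p q → Prod.Lex (· < ·) (· < ·) (φ p) (φ q)) :
    ∃ (d : K → L) (Y : K → Set L), StrictMono d ∧ (∀ k, #(Y k) = #L) ∧
      ∀ k, ∀ η ∈ Y k, ∃ l, φ (k, l) = (d k, η) := by
  obtain ⟨l₀⟩ : Nonempty L := mk_ne_zero_iff.1 hL.isRegular.ne_zero
  have hfst : ∀ k k', k < k' → ∀ l l', (φ (k, l)).1 ≤ (φ (k', l')).1 := by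
    intro k k' h l l'
    rcases Prod.lex_def.1 (hφ (k, l) (k', l') (Prod.Lex.left _ _ h)) with h | h
    · exact h.le
    · exact h.1.le
  -- Any later block bounds the columns met by block `k`, leaving fewer than `λ`; one of them
  -- receives `λ` points.
  have hcol : ∀ k, ∃ a, #{l | (φ (k, l)).1 = a} = #L := by
    intro k
    obtain ⟨k', hk'⟩ := hK.exists_gt k
    let f : L → Set.Iic (φ (k', l₀)).1 := fun l => ⟨(φ (k, l)).1, hfst k k' hk' l l₀⟩
    obtain ⟨a, ha⟩ := infinite_pigeonhole f hL.isRegular.aleph0_le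
      (by rw [hL.isRegular.cof_ord]; exact hL.mk_Iic_lt _)
    refine ⟨a, ?_⟩
    rw [← ha]
    congr 2
    ext l
    simp [f, Subtype.ext_iff]
  choose d hd using hcol
  have hsnd : ∀ k l l', (φ (k, l)).1 = d k → (φ (k, l')).1 = d k → l < l' →
      (φ (k, l)).2 < (φ (k, l')).2 := by
    intro k l l' h h' hll
    rcases Prod.lex_def.1 (hφ (k, l) (k, l') (Prod.Lex.right _ hll)) with h'' | h''
    · exact absurd (h.trans h'.symm) h''.ne
    · exact h''.2
  have hY : ∀ k, #((fun l => (φ (k, l)).2) '' {l | (φ (k, l)).1 = d k}) = #L := by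
    intro k
    rw [mk_image_eq_of_injOn, hd k]
    intro l hl l' hl' h
    by_contra hne
    rcases lt_or_gt_of_ne hne with h' | h'
    · exact (hsnd k l l' hl hl' h').ne h
    · exact (hsnd k l' l hl' hl h').ne' h
  refine ⟨d, fun k => (fun l => (φ (k, l)).2) '' {l | (φ (k, l)).1 = d k}, ?_, hY, ?_⟩
  · intro k k' h
    obtain ⟨-, ⟨l', hl', rfl⟩, -⟩ := hL.exists_mem_ge (hY k') l₀
    -- The rows of block `k` are unbounded in its column, so no later block can share that column.
    obtain ⟨-, ⟨l, hl, rfl⟩, hge⟩ := hL.exists_mem_ge (hY k) (φ (k', l')).2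
    have hl1 : (φ (k, l)).1 = d k := hl
    have hl2 : (φ (k', l')).1 = d k' := hl'
    rcases Prod.lex_def.1 (hφ (k, l) (k', l') (Prod.Lex.left _ _ h)) with h' | h'
    · rwa [hl1, hl2] at h'
    · exact absurd h'.2 hge.not_gt
  · rintro k _ ⟨l, hl, rfl⟩
    exact ⟨l, Prod.ext hl rfl⟩

end Columns

/-! ### Enumerating the two witnessing families -/

section Families

/-- Since `sInf ∅ = 0`, `lam ≠ 0` ensures that the infimum is attained. -/
theorem exists_unbounded_family {κ lam : Cardinal.{u}} (hlam : lam ≠ 0)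
    (hb : lam = unboundingNumber κ) :
    ∃ g : lam.ord.ToType → κ.ord.ToType → κ.ord.ToType,
      ∀ f : κ.ord.ToType → κ.ord.ToType, ∃ ν, #{t | f t < g ν t} = #κ.ord.ToType := by
  have hne : {c | ∃ A : Set (κ.ord.ToType → κ.ord.ToType), #A = c ∧
      ∀ f : κ.ord.ToType → κ.ord.ToType, ∃ g ∈ A,
        #{α : κ.ord.ToType | f α < g α} = κ}.Nonempty := by
    by_contra h
    rw [Set.not_nonempty_iff_eq_empty] at h
    exact hlam (by rw [hb, unboundingNumber, h, Cardinal.sInf_empty])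
  obtain ⟨A, hA, hA'⟩ := csInf_mem hne
  have hA : #lam.ord.ToType = #A := by
    rw [mk_ord_toType, hA]
    exact hb
  obtain ⟨e⟩ := Cardinal.eq.1 hA
  refine ⟨fun ν => e ν, fun f => ?_⟩
  obtain ⟨g, hg, h⟩ := hA' f
  exact ⟨e.symm ⟨g, hg⟩, by simpa using h⟩

theorem mem_subsetsOfType_ord {lam : Cardinal.{u}} {Y : Set lam.ord.ToType}
    (hY : #Y = lam) : Y ∈ subsetsOfType lam.ord.ToType lam.ord := by
  refine le_antisymm ?_ ?_
  · exact (type_set_le Y).trans_eq (type_toType _)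
  · rw [Cardinal.ord_le, card_type, hY]

theorem exists_stick_family {κ lam : Cardinal.{u}} (hlam : lam ≠ 0)
    (hsucc : lam = Order.succ κ) (hstick : lam = stickNumber κ) :
    ∃ x : lam.ord.ToType → Set lam.ord.ToType, (∀ i, #(x i) = κ) ∧
      ∀ Y : Set lam.ord.ToType, #Y = lam → ∃ i, x i ⊆ Y := by
  rw [stickNumber, stickNumber₂, ← hsucc] at hstick
  have hne : {c | ∃ X : Set (Set lam.ord.ToType), #X = c ∧
      X ⊆ subsetsOfType lam.ord.ToType κ.ord ∧
        ∀ y ∈ subsetsOfType lam.ord.ToType lam.ord, ∃ x ∈ X, x ⊆ y}.Nonempty := by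
    by_contra h
    rw [Set.not_nonempty_iff_eq_empty] at h
    exact hlam (by rw [hstick, h, Cardinal.sInf_empty])
  obtain ⟨X, hX, hXκ, hX'⟩ := csInf_mem hne
  have hX : #lam.ord.ToType = #X := by rw [mk_ord_toType, hX, ← hstick]
  obtain ⟨e⟩ := Cardinal.eq.1 hX
  refine ⟨fun i => e i, fun i => ?_, fun Y hY => ?_⟩
  · have h : Ordinal.type (fun a b : (e i : Set lam.ord.ToType) => a < b) = κ.ord :=
      hXκ (e i).2
    rw [← card_type (fun a b : (e i : Set lam.ord.ToType) => a < b), h, card_ord]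
  · obtain ⟨x, hx, h⟩ := hX' Y (mem_subsetsOfType_ord hY)
    exact ⟨e.symm ⟨x, hx⟩, by simpa using h⟩

end Families

/-! ### From graphs to colourings -/

section Colouring

/-- A symmetric graph relation without the required homogeneous sets refutes the partition
relation for pairs and two colours. -/
theorem not_partitionRelation_two {α β : Ordinal.{u}} {n : ℕ}
    (S : α.ToType → α.ToType → Prop) (hS : ∀ a b, S a b → S b a)
    (hind : ∀ X ∈ subsetsOfType α.ToType β, ∃ a ∈ X, ∃ b ∈ X, a ≠ b ∧ S a b)
    (hcl : ∀ F : Finset α.ToType, F.card = n → ∃ a ∈ F, ∃ b ∈ F, a ≠ b ∧ ¬ S a b) :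
    ¬ PartitionRelation α 2 ![β, (n : Ordinal.{u})] := by
  classical
  intro h
  obtain ⟨i, X, hX, hhom⟩ := h fun s => if ∃ a ∈ s, ∃ b ∈ s, a ≠ b ∧ S a b then 1 else 0
  have hpair : ∀ a b : α.ToType, a ≠ b → ({a, b} : Finset α.ToType) ∈
      Set.powersetCard α.ToType 2 := fun a b hab => by
    rw [Set.powersetCard.mem_iff, Finset.card_pair hab]
  fin_cases i
  · obtain ⟨a, ha, b, hb, hab, hSab⟩ := hind X hX
    have := hhom ⟨{a, b}, hpair a b hab⟩ (by
      intro c hc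
      simp only [Finset.coe_insert, Finset.coe_singleton, Set.mem_insert_iff,
        Set.mem_singleton_iff] at hc
      rcases hc with rfl | rfl <;> assumption)
    rw [if_pos] at this
    · exact absurd this (by decide)
    · refine ⟨a, ?_, b, ?_, hab, hSab⟩ <;> rw [← Set.powersetCard.mem_coe_iff] <;> simp
  · have hX4 : Ordinal.type (fun a b : X => a < b) = (n : Ordinal.{u}) := hX
    have hcard : #X = (n : Cardinal.{u}) := by
      rw [← card_type (fun a b : X => a < b), hX4, card_nat]
    obtain ⟨F, rfl, hF⟩ := mk_set_eq_nat_iff_finset.1 hcard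
    obtain ⟨a, ha, b, hb, hab, hSab⟩ := hcl F hF
    have := hhom ⟨{a, b}, hpair a b hab⟩ (by
      intro c hc
      simp only [Finset.coe_insert, Finset.coe_singleton, Set.mem_insert_iff,
        Set.mem_singleton_iff] at hc
      rcases hc with rfl | rfl <;> assumption)
    rw [if_neg] at this
    · exact absurd this (by decide)
    · rintro ⟨c, hc, c', hc', hne, hScc⟩
      rw [← Set.powersetCard.mem_coe_iff] at hc hc'
      simp only [Finset.mem_insert, Finset.mem_singleton] at hc hc'
      rcases hc with rfl | rfl <;> rcases hc' with rfl | rfl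
      · exact hne rfl
      · exact hSab hScc
      · exact hSab (hS _ _ hScc)
      · exact hne rfl

/-- Four points that are pairwise comparable by the symmetrization of `R` form an `R`-chain if
`R` increases a coordinate. -/
theorem exists_not_adj_of_card_eq_four {V L : Type*} [LinearOrder L] (c : V → L)
    {R : V → V → Prop} (hR : ∀ p q, R p q → c p < c q)
    (h4 : ∀ p q r s, R p q → R p r → R p s → R q r → R q s → R r s → False)
    (F : Finset V) (hF : F.card = 4) : ∃ a ∈ F, ∃ b ∈ F, a ≠ b ∧ ¬ (R a b ∨ R b a) := by
  classical
  by_contra! h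
  have hinj : Set.InjOn c F := by
    intro a ha b hb hab
    by_contra hne
    rcases h a ha b hb hne with h' | h'
    · exact (hR _ _ h').ne hab
    · exact (hR _ _ h').ne' hab
  have hcard : (F.image c).card = 4 := by rw [Finset.card_image_of_injOn hinj, hF]
  have hv : ∀ i : Fin 4, ∃ a ∈ F, c a = (F.image c).orderEmbOfFin hcard i := fun i =>
    Finset.mem_image.1 (Finset.orderEmbOfFin_mem _ hcard i)
  choose v hvF hv using hv
  have hadj : ∀ i j, i < j → R (v i) (v j) := by
    intro i j hij
    have hlt : c (v i) < c (v j) := by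
      rw [hv, hv]
      exact ((F.image c).orderEmbOfFin hcard).strictMono hij
    rcases h _ (hvF i) _ (hvF j) (fun he => hlt.ne (congrArg c he)) with h' | h'
    · exact h'
    · exact absurd (hR _ _ h') hlt.not_gt
  exact h4 (v 0) (v 1) (v 2) (v 3) (hadj _ _ (by decide)) (hadj _ _ (by decide))
    (hadj _ _ (by decide)) (hadj _ _ (by decide)) (hadj _ _ (by decide)) (hadj _ _ (by decide))

end Colouring

theorem mainTheorem2 (κ lam : Cardinal.{u}) (hκ : κ.IsRegular)
    (hsucc : lam = Order.succ κ) (hb : lam = unboundingNumber κ) (hstick : lam = stickNumber κ) :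
    ¬ PartitionRelation (lam.ord * lam.ord) 2 ![lam.ord * κ.ord, 4] := by
  have hlam : lam.IsRegular := hsucc ▸ isRegular_succ hκ.aleph0_le
  have hK := isRegularOrder_ord_toType hκ
  have hL := isRegularOrder_ord_toType hlam
  obtain ⟨g, hg⟩ := exists_unbounded_family hlam.ne_zero hb
  obtain ⟨x, hx, hxY⟩ := exists_stick_family hlam.ne_zero hsucc hstick
  obtain ⟨R, hR, hR4, hRind⟩ := exists_ladder_graph hK hL
    (by rw [mk_ord_toType, mk_ord_toType, hsucc]) g hg x (by simpa using hx) (by simpa using hxY)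
  obtain ⟨e⟩ : Nonempty ((fun a b : (lam.ord * lam.ord).ToType => a < b) ≃r
      Prod.Lex (fun a b : lam.ord.ToType => a < b) (fun a b : lam.ord.ToType => a < b)) := by
    rw [← type_eq, type_prod_lex, type_toType, type_toType]
  refine not_partitionRelation_two (n := 4) (fun a b => R (e a) (e b) ∨ R (e b) (e a))
    (fun a b => Or.symm) (fun X hX => ?_) fun F hF => ?_
  · have hX' : Ordinal.type (fun a b : X => a < b) = lam.ord * κ.ord := hX
    -- Lexicographic products reverse the factors: `λκ` is `κ × λ` with the `κ`-coordinate dominant.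
    obtain ⟨φ⟩ : Nonempty (Prod.Lex (fun a b : κ.ord.ToType => a < b)
        (fun a b : lam.ord.ToType => a < b) ≃r (fun a b : X => a < b)) := by
      rw [← type_eq, type_prod_lex, type_toType, type_toType, hX']
    obtain ⟨d, Y, hd, hY, hdY⟩ := exists_strictMono_columns hK hL (fun p => e (φ p))
      fun p q h => e.map_rel_iff.2 (φ.map_rel_iff.2 h)
    obtain ⟨k, l, ξ, hξ, η, hη, hadj⟩ := hRind d Y hd hY
    obtain ⟨a, ha⟩ := hdY k ξ hξ
    obtain ⟨b, hb⟩ := hdY l η hη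
    rw [← ha, ← hb] at hadj
    refine ⟨φ (k, a), (φ (k, a)).2, φ (l, b), (φ (l, b)).2, fun h => ?_, Or.inl hadj⟩
    rw [h] at hadj
    exact (hR _ _ hadj).false
  · exact exists_not_adj_of_card_eq_four (fun v => (e v).1) (R := fun a b => R (e a) (e b))
      (fun p q => hR _ _) (fun p q r s => hR4 _ _ _ _) F hF
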